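/- Let $\mathbb T$ be the unit circle with the normalized Lebesgue measure $m$, $m(\mathbb T)=1$. A Banach function norm is a map $\rho$ from the set $\mathcal M^+$ of measurable functions $\mathbb T\to[0,\infty]$ to $[0,\infty]$ such that for all $f,g,f_n\in\mathcal M^+$ and all constants $a\ge 0$: (A1) $\rho(f)=0\iff f=0$ a.e., $\rho(af)=a\rho(f)$, $\rho(f+g)\le\rho(f)+\rho(g)$; (A2) $0\le g\le f$ a.e. implies $\rho(g)\le\rho(f)$; (A3) $0\le f_n\uparrow f$ a.e. implies $\rho(f_n)\uparrow\rho(f)$; (A4) $\rho(1)<\infty$; (A5) $\int_{\mathbb T} f\,dm\le C\rho(f)$ with a constant $C\in(0,\infty)$ independent of $f$. The associated Banach function space $X$ consists of all measurable $f:\mathbb T\to\mathbb C$ (modulo equality a.e.) with $\|f\|_X:=\rho(|f|)<\infty$. It is translation-invariant if for all $f\in X$ and all $\vartheta\in[-\pi,\pi]$ the function $(\tau_\vartheta f)(e^{it})=f(e^{i(t-\vartheta)})$ is in $X$ and $\|\tau_\vartheta f\|_X=\|f\|_X$. Let $$H[X]=\{g\in X:\ \widehat g(n)=0\ \text{for all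 } n<0\},\qquad \widehat g(n)=\frac1{2\pi}\int_{-\pi}^{\pi}g(e^{i\theta})e^{-in\theta}\,d\theta ,$$ with the norm of $X$. A Banach space $E$ has the bounded compact approximation property (BCAP) if there is a constant $M\in(0,\infty)$ such that for every $\varepsilon>0$ and every finite $F\subset E$ there is a compact linear operator $T$ on $E$ with $\|I-T\|\le M$ and $\|y-Ty\|<\varepsilon$ for all $y\in F$; the infimum of such $M$ is denoted $M(E)$. It has the dual compact approximation property (DCAP) if there is a constant $M^*\in(0,\infty)$ such that for every $\varepsilon>0$ and every finite $G\subset E^*$ there is a compact linear operator $T$ on $E$ with $\|I-T\|\le M^*$ and $\|z-T^*z\|<\varepsilon$ for all $z\in G$; the infimum of such $M^*$ is denoted $M^*(E)$. **Theorem.** Let $X$ be a translation-invariant Banach function space on $\mathbb T$. (a) If $X$ is separable, then $H[X]$ has the BCAP with $M(H[X])\le 2$. (b) If $X$ is reflexive, then $H[X]$ has the BCAP and the DCAP with $M(H[X])\le 2$ and $M^*(H[X])\le 2$. -/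

import Mathlib

open MeasureTheory Filter Topology
open scoped ENNReal NNReal

noncomputable section

/-! ### The unit circle -/

/-- The circle `ℝ / 2πℤ`; the class of `t` stands for the point `e ^ (i t)` of the unit circle. -/
abbrev TCirc : Type := AddCircle (2 * Real.pi)

instance TCirc.fact_two_pi_pos : Fact (0 < 2 * Real.pi) := ⟨Real.two_pi_pos⟩

/-- Lebesgue measure on the circle, normalized to have total mass one. -/
abbrev circMeasure : Measure TCirc := AddCircle.haarAddCircle

/-! ### Banach function norms and Banach function spaces -/

/-- A Banach function norm on the nonnegative measurable functions on the circle. (Only the values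
at measurable functions are constrained, and only those values are ever used.) -/
structure BanachFunctionNorm where
  toFun : (TCirc → ℝ≥0∞) → ℝ≥0∞
  eq_zero_iff : ∀ f, Measurable f → (toFun f = 0 ↔ f =ᵐ[circMeasure] 0)
  const_mul : ∀ (a : ℝ≥0) (f), Measurable f → toFun (fun t => (a : ℝ≥0∞) * f t) = a * toFun f
  add_le : ∀ f g, Measurable f → Measurable g → toFun (fun t => f t + g t) ≤ toFun f + toFun g
  mono : ∀ f g, Measurable f → Measurable g → g ≤ᵐ[circMeasure] f → toFun g ≤ toFun f
  fatou : ∀ (f : ℕ → TCirc → ℝ≥0∞) (g), (∀ n, Measurable (f n)) → Measurable g →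
    (∀ᵐ t ∂circMeasure, Monotone fun n => f n t) →
    (∀ᵐ t ∂circMeasure, Tendsto (fun n => f n t) atTop (𝓝 (g t))) →
    Monotone (fun n => toFun (f n)) ∧ Tendsto (fun n => toFun (f n)) atTop (𝓝 (toFun g))
  one_lt_top : toFun (fun _ => 1) < ∞
  lintegral_le : ∃ C : ℝ≥0, 0 < C ∧
    ∀ f, Measurable f → ∫⁻ t, f t ∂circMeasure ≤ C * toFun f

namespace BanachFunctionNorm

variable (ρ : BanachFunctionNorm)

/-- `ρ (|f|)` for a class `f` of measurable complex functions modulo a.e. equality. -/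
def eval (f : TCirc →ₘ[circMeasure] ℂ) : ℝ≥0∞ := ρ.toFun fun t => ‖f t‖ₑ

lemma measurable_enorm_coe (f : TCirc →ₘ[circMeasure] ℂ) : Measurable fun t => ‖f t‖ₑ :=
  f.measurable.enorm

lemma eval_zero : ρ.eval 0 = 0 := by
  refine (ρ.eq_zero_iff _ (measurable_enorm_coe _)).2 ?_
  filter_upwards [AEEqFun.coeFn_zero (α := TCirc) (β := ℂ) (μ := circMeasure)] with t ht
  simp [ht]

lemma eval_add_le (f g : TCirc →ₘ[circMeasure] ℂ) : ρ.eval (f + g) ≤ ρ.eval f + ρ.eval g := by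
  refine le_trans (ρ.mono _ _ ?_ (measurable_enorm_coe _) ?_)
    (ρ.add_le _ _ (measurable_enorm_coe f) (measurable_enorm_coe g))
  · exact (measurable_enorm_coe f).add (measurable_enorm_coe g)
  · filter_upwards [AEEqFun.coeFn_add f g] with t ht
    rw [ht]
    exact enorm_add_le _ _

lemma eval_smul (c : ℂ) (f : TCirc →ₘ[circMeasure] ℂ) : ρ.eval (c • f) = ‖c‖ₑ * ρ.eval f := by
  have h := ρ.const_mul ‖c‖₊ _ (measurable_enorm_coe f)
  have hm : Measurable fun t => ((‖c‖₊ : ℝ≥0) : ℝ≥0∞) * ‖f t‖ₑ :=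
    (measurable_enorm_coe f).const_mul _
  have he : (fun t => ‖(c • f) t‖ₑ) =ᵐ[circMeasure]
      fun t => ((‖c‖₊ : ℝ≥0) : ℝ≥0∞) * ‖f t‖ₑ := by
    filter_upwards [AEEqFun.coeFn_smul c f] with t ht
    rw [ht, Pi.smul_apply, enorm_smul]
    rfl
  exact (le_antisymm (ρ.mono _ _ hm (measurable_enorm_coe _) he.le)
    (ρ.mono _ _ (measurable_enorm_coe _) hm he.symm.le)).trans h

lemma eval_neg (f : TCirc →ₘ[circMeasure] ℂ) : ρ.eval (-f) = ρ.eval f := by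
  have he : (fun t => ‖(-f) t‖ₑ) =ᵐ[circMeasure] fun t => ‖f t‖ₑ := by
    filter_upwards [AEEqFun.coeFn_neg f] with t ht
    rw [ht, Pi.neg_apply, enorm_neg]
  exact le_antisymm (ρ.mono _ _ (measurable_enorm_coe _) (measurable_enorm_coe _) he.le)
    (ρ.mono _ _ (measurable_enorm_coe _) (measurable_enorm_coe _) he.symm.le)

lemma eval_eq_zero {f : TCirc →ₘ[circMeasure] ℂ} (h : ρ.eval f = 0) : f = 0 := by
  have h' := (ρ.eq_zero_iff _ (measurable_enorm_coe f)).1 h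
  refine AEEqFun.ext ?_
  filter_upwards [h', AEEqFun.coeFn_zero (α := TCirc) (β := ℂ) (μ := circMeasure)] with t h1 h2
  rw [h2]
  simpa using h1

/-- The Banach function space of `ρ`: all `f` (modulo a.e. equality) with `ρ (|f|) < ∞`. An
extended complex valued function with `ρ (|f|) < ∞` is integrable, hence a.e. finite, so that
complex valued functions suffice. -/
def space : Submodule ℂ (TCirc →ₘ[circMeasure] ℂ) where
  carrier := {f | ρ.eval f < ∞}
  zero_mem' := by simp [eval_zero]
  add_mem' := fun {f g} hf hg => (ρ.eval_add_le f g).trans_lt (ENNReal.add_lt_top.2 ⟨hf, hg⟩)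
  smul_mem' := fun c f hf => by
    simp only [Set.mem_ofPred_eq, eval_smul]
    exact ENNReal.mul_lt_top enorm_lt_top hf

/-- The norm `‖f‖ = ρ (|f|)` of the space. -/
def spaceNorm : AddGroupNorm ρ.space where
  toFun f := (ρ.eval f).toReal
  map_zero' := by simp [eval_zero]
  add_le' f g := by
    rw [← ENNReal.toReal_add (ne_of_lt f.2) (ne_of_lt g.2)]
    exact ENNReal.toReal_mono (ENNReal.add_ne_top.2 ⟨ne_of_lt f.2, ne_of_lt g.2⟩)
      (ρ.eval_add_le f g)
  neg' f := by
    rw [Submodule.coe_neg, eval_neg]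
  eq_zero_of_map_eq_zero' f hf := by
    rcases (ENNReal.toReal_eq_zero_iff _).1 hf with h | h
    · exact Subtype.ext (ρ.eval_eq_zero h)
    · exact absurd h (ne_of_lt f.2)

instance : NormedAddCommGroup ρ.space := ρ.spaceNorm.toNormedAddCommGroup

lemma norm_def (f : ρ.space) : ‖f‖ = (ρ.eval f).toReal := rfl

instance : NormedSpace ℂ ρ.space where
  norm_smul_le c f := by
    rw [norm_def, norm_def, Submodule.coe_smul, eval_smul, ENNReal.toReal_mul, toReal_enorm]

/-- The translate `(τ_θ f)(t) = f (t - θ)`. -/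
def translate (θ : TCirc) (f : TCirc →ₘ[circMeasure] ℂ) : TCirc →ₘ[circMeasure] ℂ :=
  f.compMeasurePreserving (fun t => t - θ) (measurePreserving_sub_right circMeasure θ)

/-- Translation-invariance: `τ_θ f ∈ X` and `‖τ_θ f‖ = ‖f‖` for all `f ∈ X` and all `θ`. -/
def IsTranslationInvariant : Prop :=
  ∀ (θ : TCirc) (f : ρ.space), ∃ h : translate θ f ∈ ρ.space,
    ‖(⟨translate θ f, h⟩ : ρ.space)‖ = ‖f‖

lemma integrable_coe (f : ρ.space) :
    Integrable (f : TCirc →ₘ[circMeasure] ℂ) circMeasure := by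
  refine ⟨(f : TCirc →ₘ[circMeasure] ℂ).aestronglyMeasurable, ?_⟩
  obtain ⟨C, -, hC⟩ := ρ.lintegral_le
  exact (hC _ (measurable_enorm_coe _)).trans_lt (ENNReal.mul_lt_top ENNReal.coe_lt_top f.2)

/-- The abstract Hardy space `H[X]` of all `g ∈ X` whose Fourier coefficients of negative index
vanish, with the norm of `X`. -/
def hardy : Submodule ℂ ρ.space where
  carrier := {g | ∀ n : ℤ, n < 0 → fourierCoeff (g : TCirc →ₘ[circMeasure] ℂ) n = 0}
  zero_mem' := by
    intro n _
    rw [fourierCoeff, ← integral_zero TCirc ℂ (μ := circMeasure)]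
    refine integral_congr_ae ?_
    filter_upwards [AEEqFun.coeFn_zero (α := TCirc) (β := ℂ) (μ := circMeasure)] with t ht
    simp [ht]
  add_mem' := by
    intro f g hf hg n hn
    have h : fourierCoeff ((f + g : ρ.space) : TCirc →ₘ[circMeasure] ℂ) n =
        fourierCoeff ((f : TCirc →ₘ[circMeasure] ℂ) + (g : TCirc →ₘ[circMeasure] ℂ) :
          TCirc → ℂ) n := by
      refine integral_congr_ae ?_
      filter_upwards [AEEqFun.coeFn_add (f : TCirc →ₘ[circMeasure] ℂ) g] with t ht
      simp only [Submodule.coe_add, ht]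
    rw [h, fourierCoeff.add (ρ.integrable_coe f) (ρ.integrable_coe g), Pi.add_apply,
      hf n hn, hg n hn, add_zero]
  smul_mem' := by
    intro c f hf n hn
    have h : fourierCoeff ((c • f : ρ.space) : TCirc →ₘ[circMeasure] ℂ) n =
        fourierCoeff (c • (f : TCirc →ₘ[circMeasure] ℂ) : TCirc → ℂ) n := by
      refine integral_congr_ae ?_
      filter_upwards [AEEqFun.coeFn_smul c (f : TCirc →ₘ[circMeasure] ℂ)] with t ht
      simp only [Submodule.coe_smul, ht]
    rw [h, fourierCoeff.const_smul, hf n hn, smul_zero]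

end BanachFunctionNorm

/-! ### Approximation properties -/

section Approximation

variable (E : Type*) [NormedAddCommGroup E] [NormedSpace ℂ E]

/-- `E` is reflexive: the canonical isometry into the bidual is onto. -/
def IsReflexiveSpace : Prop :=
  Function.Surjective (NormedSpace.inclusionInDoubleDual ℂ E)

/-- The condition in the bounded compact approximation property, with the constant `M`. -/
def BCAPWith (M : ℝ) : Prop :=
  ∀ ε : ℝ, 0 < ε → ∀ F : Finset E, ∃ T : E →L[ℂ] E, IsCompactOperator T ∧
    ‖ContinuousLinearMap.id ℂ E - T‖ ≤ M ∧ ∀ y ∈ F, ‖y - T y‖ < ε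

/-- The bounded compact approximation property. -/
def HasBCAP : Prop := ∃ M : ℝ, 0 < M ∧ BCAPWith E M

/-- The constant `M(E)`, for a space `E` with the bounded compact approximation property. -/
def bcapConst : ℝ := sInf {M : ℝ | 0 < M ∧ BCAPWith E M}

/-- The condition in the dual compact approximation property, with the constant `M`; here
`z.comp T` is `T* z`. -/
def DCAPWith (M : ℝ) : Prop :=
  ∀ ε : ℝ, 0 < ε → ∀ G : Finset (StrongDual ℂ E), ∃ T : E →L[ℂ] E, IsCompactOperator T ∧
    ‖ContinuousLinearMap.id ℂ E - T‖ ≤ M ∧ ∀ z ∈ G, ‖z - z.comp T‖ < ε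

/-- The dual compact approximation property. -/
def HasDCAP : Prop := ∃ M : ℝ, 0 < M ∧ DCAPWith E M

/-- The constant `M*(E)`, for a space `E` with the dual compact approximation property. -/
def dcapConst : ℝ := sInf {M : ℝ | 0 < M ∧ DCAPWith E M}

end Approximation

end

noncomputable section

/-! ### Convolution on `L¹` of the circle -/

/-! Convolution with a trigonometric polynomial has finite rank and maps `H[X]` into itself. Let `φ`
be a continuous probability density supported near `0` and `p` a trigonometric polynomial uniformly
within `η` of `φ`. Then `f - p * f` is the `φ`-average of `f - τ_θ f` plus the small term `(φ - p) *
f`. Averages are formed in `L¹`, where translation is always continuous; norm bounds carry over to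
`X` because sublevel sets of `ρ` are convex and, by the Fatou property, closed in `L¹`
(`isClosed_eval_le`, `sub_conv_le`). Since `‖f - τ_θ f‖ ≤ 2 ‖f‖`, the operator `T = p * ·` satisfies
`‖I - T‖ ≤ 2 + η`.

If `X` is separable, a Baire category argument makes translation continuous at `0` in `X`
(`eventually_eval_sub_trans_le`), so these operators approximate the identity pointwise in norm. If
`X` is reflexive, approximation in `L¹` is enough: the adjoint of the injection `H[X] → L¹` has
dense range, so bounded `L¹`-approximation is weak approximation, and Mazur's lemma upgrades it to
norm approximation by convex combinations (`BCAPWith.of_injective`). The same convexity argument,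
with functionals on the dual represented by points, gives the DCAP (`BCAPWith.dcapWith`). -/

/-- The space `L¹` of the circle. -/
abbrev CircL1 : Type := Lp ℂ 1 circMeasure

namespace CircL1

/-- Translation on `L¹` of the circle, as a linear isometry. -/
def trans (θ : TCirc) : CircL1 →ₗᵢ[ℂ] CircL1 :=
  Lp.compMeasurePreservingₗᵢ ℂ (fun t => t - θ) (measurePreserving_sub_right circMeasure θ)

lemma coeFn_trans (θ : TCirc) (f : CircL1) :
    trans θ f =ᵐ[circMeasure] fun t => f (t - θ) :=
  Lp.coeFn_compMeasurePreserving f (measurePreserving_sub_right circMeasure θ)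

lemma trans_zero (f : CircL1) : trans 0 f = f := by
  apply Lp.ext
  filter_upwards [coeFn_trans 0 f] with t ht
  rw [ht, sub_zero]

lemma trans_add (θ s : TCirc) (f : CircL1) : trans (θ + s) f = trans θ (trans s f) := by
  apply Lp.ext
  have h := (measurePreserving_sub_right circMeasure θ).quasiMeasurePreserving.ae_eq_comp
    (coeFn_trans s f)
  filter_upwards [coeFn_trans (θ + s) f, coeFn_trans θ (trans s f), h] with t h1 h2 h3
  rw [h1, h2]
  simp only [Function.comp_apply] at h3
  rw [h3, sub_sub]

/-- Holds because the exponent `1` is finite. It makes the vector-valued integrals below meaningful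
without any continuity of translation in `X`. -/
lemma continuous_trans (f : CircL1) : Continuous fun θ => trans θ f := by
  let g : TCirc → C(TCirc, TCirc) := fun θ => ⟨fun t => t - θ, by fun_prop⟩
  have hg : Continuous g := ContinuousMap.continuous_of_continuous_uncurry _ (by
    change Continuous fun p : TCirc × TCirc => p.2 - p.1
    fun_prop)
  exact Continuous.compMeasurePreservingLp (p := 1) (f := fun _ : TCirc => f) (g := g)
    continuous_const hg (fun θ => measurePreserving_sub_right circMeasure θ) ENNReal.one_ne_top

lemma integrable_of_continuous {E : Type*} [NormedAddCommGroup E] {g : TCirc → E}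
    (hg : Continuous g) : Integrable g circMeasure :=
  hg.integrable_of_hasCompactSupport (HasCompactSupport.of_compactSpace g)

lemma continuous_smul_trans (k : C(TCirc, ℂ)) (f : CircL1) :
    Continuous fun θ => k θ • trans θ f :=
  k.continuous.smul (continuous_trans f)

/-- The convolution `k * f` of a continuous kernel with an integrable function, as an average of
translates of `f`. -/
def conv (k : C(TCirc, ℂ)) : CircL1 →L[ℂ] CircL1 :=
  LinearMap.mkContinuous
    { toFun := fun f => ∫ θ, k θ • trans θ f ∂circMeasure
      map_add' := fun f g => by
        rw [← integral_add (integrable_of_continuous (continuous_smul_trans k f))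
          (integrable_of_continuous (continuous_smul_trans k g))]
        simp only [map_add, smul_add]
      map_smul' := fun c f => by
        rw [RingHom.id_apply, ← integral_smul]
        simp only [map_smul, smul_comm c] }
    ‖k‖ fun f => by
      refine (norm_integral_le_of_norm_le_const (C := ‖k‖ * ‖f‖) (ae_of_all _ fun θ => ?_)).trans ?_
      · rw [norm_smul, LinearIsometry.norm_map]
        gcongr
        exact k.norm_coe_le_norm θ
      · simp

lemma conv_apply (k : C(TCirc, ℂ)) (f : CircL1) :
    conv k f = ∫ θ, k θ • trans θ f ∂circMeasure := rfl

lemma conv_add (k l : C(TCirc, ℂ)) (f : CircL1) : conv (k + l) f = conv k f + conv l f := by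
  simp only [conv_apply]
  rw [← integral_add (integrable_of_continuous (continuous_smul_trans k f))
    (integrable_of_continuous (continuous_smul_trans l f))]
  simp only [ContinuousMap.add_apply, add_smul]

lemma conv_smul (c : ℂ) (k : C(TCirc, ℂ)) (f : CircL1) : conv (c • k) f = c • conv k f := by
  simp only [conv_apply]
  rw [← integral_smul]
  simp only [ContinuousMap.smul_apply, smul_assoc]

lemma conv_zero (f : CircL1) : conv 0 f = 0 := by
  simp [conv_apply]

/-! ### Fourier coefficients and convolution with characters -/

/-- The `n`-th Fourier coefficient as a continuous linear functional on `L¹`. -/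
def coeff (n : ℤ) : CircL1 →L[ℂ] ℂ :=
  LinearMap.mkContinuous
    { toFun := fun f => fourierCoeff f n
      map_add' := fun f g => by
        rw [fourierCoeff_congr_ae (Lp.coeFn_add f g),
          fourierCoeff.add (L1.integrable_coeFn f) (L1.integrable_coeFn g), Pi.add_apply]
      map_smul' := fun c f => by
        rw [fourierCoeff_congr_ae (Lp.coeFn_smul c f), fourierCoeff.const_smul, RingHom.id_apply] }
    1 fun f => by
      rw [one_mul, L1.norm_eq_integral_norm]
      refine (norm_integral_le_integral_norm _).trans (le_of_eq ?_)
      refine integral_congr_ae (ae_of_all _ fun t => ?_)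
      simp only [norm_smul, fourier_apply, Circle.norm_coe, one_mul]

lemma coeff_apply (n : ℤ) (f : CircL1) : coeff n f = fourierCoeff f n := rfl

lemma coeff_fourierLp (n j : ℤ) :
    coeff n (fourierLp 1 j) = (Pi.single j 1 : ℤ → ℂ) n := by
  rw [coeff_apply, fourierCoeff_congr_ae (coeFn_fourierLp 1 j), fourierCoeff_fourier]

lemma fourier_apply_neg (n : ℤ) (t : TCirc) : fourier n (-t) = fourier (-n) t := by
  simp [fourier_apply]

lemma fourier_apply_add (n : ℤ) (s t : TCirc) :
    fourier n (s + t) = fourier n s * fourier n t := by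
  simp [fourier_apply, AddCircle.toCircle_add]

lemma trans_fourierLp (θ : TCirc) (j : ℤ) :
    trans θ (fourierLp 1 j) = (fourier j (-θ) : ℂ) • fourierLp 1 j := by
  apply Lp.ext
  have h := (measurePreserving_sub_right circMeasure θ).quasiMeasurePreserving.ae_eq_comp
    (coeFn_fourierLp (T := 2 * Real.pi) 1 j)
  filter_upwards [coeFn_trans θ (fourierLp 1 j), h,
    Lp.coeFn_smul (fourier j (-θ) : ℂ) (fourierLp (T := 2 * Real.pi) 1 j),
    coeFn_fourierLp (T := 2 * Real.pi) 1 j] with t h1 h2 h3 h4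
  simp only [Function.comp_apply] at h2
  rw [h1, h2, h3, Pi.smul_apply, h4, sub_eq_add_neg, fourier_apply_add, smul_eq_mul, mul_comm]

lemma conv_fourier_fourierLp (n j : ℤ) :
    conv (fourier n) (fourierLp 1 j) = (Pi.single j 1 : ℤ → ℂ) n • fourierLp 1 j := by
  simp only [conv_apply, trans_fourierLp, smul_smul]
  rw [integral_smul_const]
  congr 1
  -- The substitution `θ ↦ -θ` turns the scalar factor into the `n`-th coefficient of the `j`-th
  -- character.
  rw [← integral_neg_eq_self, ← fourierCoeff_fourier (T := 2 * Real.pi) j]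
  simp only [neg_neg, fourier_apply_neg, fourierCoeff, smul_eq_mul]

/-- Convolution with a character is the corresponding Fourier projection. -/
lemma conv_fourier (n : ℤ) (f : CircL1) :
    conv (fourier n) f = coeff n f • fourierLp 1 n := by
  have h : conv (fourier n) = (coeff n).smulRight (fourierLp 1 n) := by
    -- Both operators are continuous and the characters span a dense subspace of `L¹`.
    refine ContinuousLinearMap.ext_on (s := Set.range (fourierLp 1)) ?_ ?_
    · rw [Submodule.dense_iff_topologicalClosure_eq_top]
      exact span_fourierLp_closure_eq_top ENNReal.one_ne_top
    · rintro _ ⟨j, rfl⟩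
      rw [conv_fourier_fourierLp, ContinuousLinearMap.smulRight_apply, coeff_fourierLp]
      by_cases hj : n = j
      · rw [hj]
      · simp [hj]
  rw [h, ContinuousLinearMap.smulRight_apply]

/-! ### Averaging against densities concentrated near `0` -/

/-- A weighted average of points of a closed convex set stays in the set. -/
lemma integral_smul_mem {B : Set CircL1} (hB : Convex ℝ B) (hBc : IsClosed B)
    {φ : C(TCirc, ℝ≥0)} (hφ : ∫⁻ t, φ t ∂circMeasure = 1) {g : TCirc → CircL1}
    (hg : Continuous g) (hgB : ∀ θ, φ θ ≠ 0 → g θ ∈ B) :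
    ∫ θ, ((φ θ : ℝ) : ℂ) • g θ ∂circMeasure ∈ B := by
  have hm : Measurable φ := φ.continuous.measurable
  have : IsProbabilityMeasure (circMeasure.withDensity fun t => (φ t : ℝ≥0∞)) :=
    ⟨by rw [withDensity_apply _ MeasurableSet.univ, Measure.restrict_univ, hφ]⟩
  have h := hB.integral_mem (μ := circMeasure.withDensity fun t => (φ t : ℝ≥0∞)) (f := g) hBc ?_ ?_
  · rw [integral_withDensity_eq_integral_smul hm] at h
    exact h
  · rw [ae_withDensity_iff hm.coe_nnreal_ennreal]
    exact ae_of_all _ fun t ht => hgB t (by simpa using ht)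
  · exact hg.integrable_of_hasCompactSupport (HasCompactSupport.of_compactSpace g)

/-- A continuous probability density supported in a given neighbourhood of `0`. -/
lemma exists_density {V : Set TCirc} (hV : V ∈ 𝓝 0) :
    ∃ φ : C(TCirc, ℝ≥0), ∫⁻ t, φ t ∂circMeasure = 1 ∧ ∀ θ, φ θ ≠ 0 → θ ∈ V := by
  -- A Urysohn function, `1` at `0` and `0` off the interior of `V`, to be normalized.
  obtain ⟨f, h0, h1, h01⟩ := exists_continuous_zero_one_of_isClosed
    (isOpen_interior (s := V)).isClosed_compl (isClosed_singleton (x := (0 : TCirc)))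
    (Set.disjoint_singleton_right.2 fun h => h (mem_interior_iff_mem_nhds.2 hV))
  let ψ : C(TCirc, ℝ≥0) := ⟨fun t => (f t).toNNReal, by fun_prop⟩
  have hψ : ∀ θ, ψ θ ≠ 0 → θ ∈ V := fun θ hθ => by
    by_contra hθV
    apply hθ
    have : f θ = 0 := h0 fun h => hθV (interior_subset h)
    simp [ψ, this]
  have hψ0 : ψ 0 = 1 := by
    have : f 0 = 1 := h1 rfl
    simp [ψ, this]
  have hm : Measurable fun t => (ψ t : ℝ≥0∞) := ψ.continuous.measurable.coe_nnreal_ennreal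
  have hpos : ∫⁻ t, ψ t ∂circMeasure ≠ 0 := by
    intro h
    rw [lintegral_eq_zero_iff hm] at h
    -- Haar measure charges open sets, so a continuous function that is zero a.e. is zero
    -- everywhere.
    have := (Continuous.ae_eq_iff_eq circMeasure
      (ENNReal.continuous_coe.comp ψ.continuous) continuous_const).1 h
    have := congrFun this 0
    simp [hψ0] at this
  have htop : ∫⁻ t, ψ t ∂circMeasure ≠ ∞ := by
    refine ((lintegral_mono (g := fun _ => 1) fun t => ?_).trans_lt ?_).ne
    · simpa [ψ] using (h01 t).2
    · simp
  lift (∫⁻ t, (ψ t : ℝ≥0∞) ∂circMeasure) to ℝ≥0 using htop with a ha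
  have ha0 : a ≠ 0 := by simpa using hpos
  refine ⟨⟨fun t => a⁻¹ * ψ t, by fun_prop⟩, ?_, fun θ hθ => hψ θ (right_ne_zero_of_mul hθ)⟩
  simp only [ContinuousMap.coe_mk, ENNReal.coe_mul]
  rw [lintegral_const_mul _ hm, ← ha, ← ENNReal.coe_mul, inv_mul_cancel₀ ha0, ENNReal.coe_one]

/-- Trigonometric polynomials are uniformly dense. -/
lemma exists_trigPoly_norm_sub_le (k : C(TCirc, ℂ)) {η : ℝ} (hη : 0 < η) :
    ∃ p ∈ Submodule.span ℂ (Set.range (fourier (T := 2 * Real.pi))), ‖k - p‖ ≤ η := by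
  have h : k ∈ (Submodule.span ℂ (Set.range (fourier (T := 2 * Real.pi)))).topologicalClosure := by
    rw [span_fourier_closure_eq_top]; trivial
  obtain ⟨p, hp, hkp⟩ := Metric.mem_closure_iff.1 h η hη
  exact ⟨p, hp, by rw [← dist_eq_norm]; exact hkp.le⟩

/-- A convolution approximates the identity, in any lower semicontinuous seminorm that translation
does not increase, as well as the translates with small parameter do. -/
lemma sub_conv_le {N : CircL1 → ℝ≥0∞} (hclosed : ∀ c, IsClosed {f | N f ≤ c})
    (hadd : ∀ f g, N (f + g) ≤ N f + N g) (hsmul : ∀ (c : ℂ) f, N (c • f) = ‖c‖ₑ * N f)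
    {φ : C(TCirc, ℝ≥0)} (hφ : ∫⁻ t, φ t ∂circMeasure = 1) {k p : C(TCirc, ℂ)}
    (hk : ∀ θ, k θ = (φ θ : ℝ)) {η : ℝ} (hkp : ‖k - p‖ ≤ η) {f : CircL1}
    (hf : ∀ θ, N (trans θ f) ≤ N f) {c : ℝ≥0∞} (hc : ∀ θ, φ θ ≠ 0 → N (f - trans θ f) ≤ c) :
    N (f - conv p f) ≤ c + ENNReal.ofReal η * N f := by
  have hconv : ∀ c, Convex ℝ {f | N f ≤ c} := fun c u hu v hv a b ha hb hab => by
    have h : a • u + b • v = (a : ℂ) • u + (b : ℂ) • v := rfl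
    rw [Set.mem_ofPred_eq, h]
    refine (hadd _ _).trans ?_
    rw [hsmul, hsmul]
    calc ‖(a : ℂ)‖ₑ * N u + ‖(b : ℂ)‖ₑ * N v ≤ ‖(a : ℂ)‖ₑ * c + ‖(b : ℂ)‖ₑ * c :=
          add_le_add (mul_le_mul_right hu _) (mul_le_mul_right hv _)
      _ = c := by
          rw [← add_mul, ← ofReal_norm, ← ofReal_norm, Complex.norm_real, Complex.norm_real,
            Real.norm_of_nonneg ha, Real.norm_of_nonneg hb, ← ENNReal.ofReal_add ha hb, hab,
            ENNReal.ofReal_one, one_mul]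
  have h1 : ∫ θ, ((φ θ : ℝ) : ℂ) • (f - trans θ f) ∂circMeasure ∈ {f | N f ≤ c} :=
    integral_smul_mem (hconv c) (hclosed c) hφ (continuous_const.sub (continuous_trans f)) hc
  have h2 : conv (k - p) f ∈ {g | N g ≤ ENNReal.ofReal η * N f} := by
    -- The kernel `k - p` has no sign, so it goes into the integrand and the density is constant.
    have h := integral_smul_mem (hconv (ENNReal.ofReal η * N f)) (hclosed _) (φ := 1) (by simp)
      (continuous_smul_trans (k - p) f) (fun θ _ => ?_)
    · simpa [conv_apply] using h
    · rw [Set.mem_ofPred_eq, hsmul]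
      refine mul_le_mul' ?_ (hf θ)
      rw [← ofReal_norm]
      exact ENNReal.ofReal_le_ofReal (((k - p).norm_coe_le_norm θ).trans hkp)
  have h3 : f - conv p f =
      (∫ θ, ((φ θ : ℝ) : ℂ) • (f - trans θ f) ∂circMeasure) + conv (k - p) f := by
    have hone : ∫ θ, ((φ θ : ℝ) : ℂ) ∂circMeasure = 1 := by
      have h : ∫ θ, (φ θ : ℝ) ∂circMeasure = 1 := by
        rw [integral_eq_lintegral_of_nonneg_ae (f := fun θ => (φ θ : ℝ))
          (ae_of_all _ fun t => (φ t).2)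
          (NNReal.continuous_coe.comp φ.continuous).aestronglyMeasurable]
        simp [hφ]
      rw [integral_complex_ofReal, h, Complex.ofReal_one]
    have hk' : conv (k - p) f = conv k f - conv p f := by
      rw [eq_sub_iff_add_eq, ← conv_add, sub_add_cancel]
    have hint : Continuous fun θ => ((φ θ : ℝ) : ℂ) := by fun_prop
    have hkc : conv k f = ∫ θ, ((φ θ : ℝ) : ℂ) • trans θ f ∂circMeasure := by
      simp only [conv_apply, hk]
    have hsub : ∫ θ, (((φ θ : ℝ) : ℂ) • f - ((φ θ : ℝ) : ℂ) • trans θ f) ∂circMeasure =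
        (∫ θ, ((φ θ : ℝ) : ℂ) • f ∂circMeasure) - ∫ θ, ((φ θ : ℝ) : ℂ) • trans θ f ∂circMeasure :=
      integral_sub (integrable_of_continuous (hint.smul continuous_const))
        (integrable_of_continuous (hint.smul (continuous_trans f)))
    simp only [smul_sub]
    rw [hsub, integral_smul_const, hone, one_smul, hk', hkc]
    abel
  rw [h3]
  exact (hadd _ _).trans (add_le_add h1 h2)

end CircL1

/-! ### Duality and compact approximation -/

section Duality

variable {E : Type*} [NormedAddCommGroup E] [NormedSpace ℂ E]

/-- A point outside the closure of a subspace is separated from it by a functional. -/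
lemma exists_dual_vanishing_of_notMem_closure (S : Submodule ℂ E) {x : E}
    (hx : x ∉ closure (S : Set E)) : ∃ Φ : StrongDual ℂ E, (∀ b ∈ S, Φ b = 0) ∧ Φ x ≠ 0 := by
  obtain ⟨Φ, u, hu, hS⟩ := RCLike.geometric_hahn_banach_point_closed (𝕜 := ℂ)
    ((S.restrictScalars ℝ).convex.closure) isClosed_closure hx
  refine ⟨Φ, fun b hb => ?_, fun h => ?_⟩
  · by_contra hb0
    -- This multiple of `b` is sent exactly to `u`, against the strict bound on `S`.
    have := hS (((u : ℂ) / Φ b) • b) (subset_closure (S.smul_mem _ hb))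
    rw [map_smul, smul_eq_mul, div_mul_cancel₀ _ hb0] at this
    simp at this
  · have := hS 0 (subset_closure S.zero_mem)
    simp [h] at hu this
    linarith

/-- A closed subspace of a reflexive space is reflexive. -/
lemma IsReflexiveSpace.of_isClosed (hE : IsReflexiveSpace E) (S : Submodule ℂ E)
    (hS : IsClosed (S : Set E)) : IsReflexiveSpace S := by
  intro Φ
  -- `x` represents the functional `z ↦ Φ (z|_S)` on the dual of `E`.
  obtain ⟨x, hx⟩ := hE (Φ.comp ((ContinuousLinearMap.compL ℂ S E ℂ).flip S.subtypeL))
  have hΦ : ∀ z : StrongDual ℂ E, z x = Φ (z.comp S.subtypeL) := fun z => by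
    have := congrArg (fun Ψ => Ψ z) hx
    simpa [NormedSpace.dual_def] using this
  have hxS : x ∈ S := by
    by_contra hxS
    obtain ⟨z, hz, hzx⟩ := exists_dual_vanishing_of_notMem_closure S (x := x)
      (by rwa [hS.closure_eq])
    have : z.comp S.subtypeL = 0 := by
      ext b
      exact hz b b.2
    exact hzx (by rw [hΦ, this, map_zero])
  refine ⟨⟨x, hxS⟩, ?_⟩
  ext z
  obtain ⟨g, hg, -⟩ := exists_extension_norm_eq S z
  have : g.comp S.subtypeL = z := by
    ext b
    exact hg b
  rw [NormedSpace.dual_def, ← hg, hΦ, this]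

/-- The adjoint of an injective operator on a reflexive space has dense range. -/
lemma IsReflexiveSpace.exists_comp_norm_sub_lt (hE : IsReflexiveSpace E)
    {G : Type*} [NormedAddCommGroup G] [NormedSpace ℂ G] (J : E →L[ℂ] G)
    (hJ : Function.Injective J) (z : StrongDual ℂ E) {δ : ℝ} (hδ : 0 < δ) :
    ∃ g : StrongDual ℂ G, ‖z - g.comp J‖ < δ := by
  let A : StrongDual ℂ G →ₗ[ℂ] StrongDual ℂ E :=
    ((ContinuousLinearMap.compL ℂ E G ℂ).flip J : StrongDual ℂ G →ₗ[ℂ] StrongDual ℂ E)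
  have hA : ∀ g, A g = g.comp J := fun g => rfl
  have hz : z ∈ closure (LinearMap.range A : Set (StrongDual ℂ E)) := by
    by_contra hz
    obtain ⟨Φ, hΦ, hΦz⟩ := exists_dual_vanishing_of_notMem_closure _ hz
    -- An annihilator of the range is evaluation at some `x` with `g (J x) = 0` for every `g`, hence
    -- `J x = 0`.
    obtain ⟨x, rfl⟩ := hE Φ
    have hx : x = 0 := by
      apply hJ
      rw [map_zero]
      by_contra hne
      obtain ⟨g, -, hg⟩ := exists_dual_vector ℂ (J x) (norm_ne_zero_iff.2 hne)
      have := hΦ (A g) ⟨g, rfl⟩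
      rw [NormedSpace.dual_def, hA, ContinuousLinearMap.comp_apply, hg] at this
      exact hne (by simpa using this)
    exact hΦz (by rw [hx, map_zero, zero_apply])
  obtain ⟨_, ⟨g, rfl⟩, hg⟩ := Metric.mem_closure_iff.1 hz δ hδ
  exact ⟨g, by rwa [← hA, ← dist_eq_norm]⟩

/-! ### From weak to norm approximation by convexity -/

/-- Mazur's lemma for finite families of vectors. -/
lemma Convex.exists_norm_sub_lt_of_weak {ι : Type*} [Fintype ι] {C : Set (ι → E)}
    (hC : Convex ℝ C) (v : ι → E)
    (h : ∀ ψ : ι → StrongDual ℂ E, ∀ δ : ℝ, 0 < δ → ∃ w ∈ C, ‖∑ i, ψ i (v i - w i)‖ < δ)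
    {ε : ℝ} (hε : 0 < ε) : ∃ w ∈ C, ∀ i, ‖v i - w i‖ < ε := by
  classical
  have hv : v ∈ closure C := by
    by_contra hv
    obtain ⟨Φ, u, hu, hS⟩ := RCLike.geometric_hahn_banach_point_closed (𝕜 := ℂ)
      hC.closure isClosed_closure hv
    -- The coordinates of the separating functional are tested with `δ` equal to the separation gap.
    obtain ⟨w, hw, hlt⟩ := h (fun i => Φ.comp (ContinuousLinearMap.single ℂ (fun _ => E) i))
      (u - RCLike.re (Φ v)) (by linarith)
    have hsum : ∑ i, (Φ.comp (ContinuousLinearMap.single ℂ (fun _ => E) i)) (v i - w i) =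
        Φ v - Φ w := by
      rw [← map_sub]
      conv_rhs => rw [← Finset.univ_sum_single (v - w), map_sum]
      rfl
    rw [hsum] at hlt
    have h1 := hS w (subset_closure hw)
    have h2 : RCLike.re (Φ w - Φ v) ≤ ‖Φ w - Φ v‖ := RCLike.re_le_norm _
    rw [map_sub, norm_sub_rev] at h2
    linarith
  obtain ⟨w, hw, hd⟩ := Metric.mem_closure_iff.1 hv ε hε
  refine ⟨w, hw, fun i => ?_⟩
  rw [← dist_eq_norm]
  exact (dist_le_pi_dist v w i).trans_lt hd

/-- The compact operators within distance `M` of the identity form a convex set. -/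
lemma convex_compact_norm_id_sub_le (M : ℝ) :
    Convex ℝ {T : E →L[ℂ] E | IsCompactOperator T ∧ ‖ContinuousLinearMap.id ℂ E - T‖ ≤ M} := by
  have h1 : Convex ℝ {T : E →L[ℂ] E | IsCompactOperator T} := fun S hS T hT a b _ _ _ => by
    exact (hS.smul a).add (hT.smul b)
  have h2 := convex_closedBall (E := E →L[ℂ] E) (ContinuousLinearMap.id ℂ E) M
  convert h1.inter h2 using 1
  ext T
  simp [dist_eq_norm, norm_sub_rev]

/-- It is enough to approximate the identity weakly. -/
lemma BCAPWith.of_weak {M : ℝ}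
    (h : ∀ (F : Finset E) (ψ : F → StrongDual ℂ E) (δ : ℝ), 0 < δ → ∃ T : E →L[ℂ] E,
      IsCompactOperator T ∧ ‖ContinuousLinearMap.id ℂ E - T‖ ≤ M ∧
        ‖∑ y : F, ψ y (y - T y)‖ < δ) : BCAPWith E M := by
  intro ε hε F
  let S : Set (E →L[ℂ] E) :=
    {T | IsCompactOperator T ∧ ‖ContinuousLinearMap.id ℂ E - T‖ ≤ M}
  have hC : Convex ℝ {w : F → E | ∃ T ∈ S, ∀ y : F, w y = T y} := by
    rintro v ⟨T, hT, hv⟩ w ⟨U, hU, hw⟩ a b ha hb hab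
    refine ⟨a • T + b • U, convex_compact_norm_id_sub_le M hT hU ha hb hab, fun y => ?_⟩
    simp [hv, hw]
  obtain ⟨w, ⟨T, hT, hw⟩, hlt⟩ := hC.exists_norm_sub_lt_of_weak
      (fun y => (y : E)) (fun ψ δ hδ => by
        obtain ⟨T, h1, h2, h3⟩ := h F ψ δ hδ
        exact ⟨fun y => T y, ⟨T, ⟨h1, h2⟩, fun _ => rfl⟩, h3⟩) hε
  refine ⟨T, hT.1, hT.2, fun y hy => ?_⟩
  have := hlt ⟨y, hy⟩
  rwa [hw] at this

/-- In a reflexive space, it is enough to approximate the identity in the norm of a larger space. -/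
lemma BCAPWith.of_injective (hr : IsReflexiveSpace E) {M : ℝ} (hM : 0 ≤ M)
    {G : Type*} [NormedAddCommGroup G] [NormedSpace ℂ G] (J : E →L[ℂ] G)
    (hJ : Function.Injective J)
    (h : ∀ (F : Finset E) (ε : ℝ), 0 < ε → ∃ T : E →L[ℂ] E, IsCompactOperator T ∧
      ‖ContinuousLinearMap.id ℂ E - T‖ ≤ M ∧ ∀ y ∈ F, ‖J (y - T y)‖ < ε) :
    BCAPWith E M := by
  refine BCAPWith.of_weak fun F ψ δ hδ => ?_
  have hK0 : 0 ≤ ∑ y : F, M * ‖(y : E)‖ :=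
    Finset.sum_nonneg fun _ _ => by positivity
  -- `K` bounds the sum of the `‖y - T y‖` for every admissible `T`, so the `g y` can be fixed
  -- before `T` is chosen.
  set K : ℝ := ∑ y : F, M * ‖(y : E)‖ with hK
  choose g hg using fun y : F =>
    hr.exists_comp_norm_sub_lt J hJ (ψ y) (δ := δ / 2 / (K + 1)) (by positivity)
  have hL0 : 0 ≤ ∑ y : F, ‖g y‖ := Finset.sum_nonneg fun _ _ => norm_nonneg _
  set L : ℝ := ∑ y : F, ‖g y‖ with hL
  obtain ⟨T, hT, hTn, hTa⟩ := h F (δ / 2 / (L + 1)) (by positivity)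
  refine ⟨T, hT, hTn, ?_⟩
  have hterm : ∀ y : F, ‖ψ y (y - T y)‖ ≤
      δ / 2 / (K + 1) * (M * ‖(y : E)‖) + ‖g y‖ * (δ / 2 / (L + 1)) := fun y => by
    have h1 : ψ y (y - T y) =
        (ψ y - (g y).comp J) (y - T y) + g y (J (y - T y)) := by
      rw [sub_apply, ContinuousLinearMap.comp_apply, sub_add_cancel]
    have h2 : ‖(y : E) - T y‖ ≤ M * ‖(y : E)‖ :=
      (ContinuousLinearMap.id ℂ E - T).le_of_opNorm_le hTn y
    rw [h1]
    refine (norm_add_le _ _).trans (add_le_add ?_ ?_)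
    · refine (ContinuousLinearMap.le_opNorm _ _).trans ?_
      exact mul_le_mul (hg y).le h2 (norm_nonneg _) (by positivity)
    · refine (ContinuousLinearMap.le_opNorm _ _).trans ?_
      exact mul_le_mul_of_nonneg_left (hTa y y.2).le (norm_nonneg _)
  calc ‖∑ y : F, ψ y (y - T y)‖ ≤ δ / 2 / (K + 1) * K + L * (δ / 2 / (L + 1)) := by
        refine (norm_sum_le _ _).trans ((Finset.sum_le_sum fun y _ => hterm y).trans_eq ?_)
        rw [Finset.sum_add_distrib, ← Finset.mul_sum, ← Finset.sum_mul]
    _ < δ := by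
        have h1 : δ / 2 / (K + 1) * K < δ / 2 := by
          rw [div_mul_eq_mul_div, div_lt_iff₀ (by positivity)]
          linarith
        have h2 : L * (δ / 2 / (L + 1)) < δ / 2 := by
          rw [← mul_div_assoc, div_lt_iff₀ (by positivity)]
          linarith
        linarith

/-- In a reflexive space, compact approximation dualizes, with the same constant. -/
lemma BCAPWith.dcapWith {M : ℝ} (h : BCAPWith E M) (hE : IsReflexiveSpace E) :
    DCAPWith E M := by
  classical
  intro ε hε G
  let S : Set (E →L[ℂ] E) :=
    {T | IsCompactOperator T ∧ ‖ContinuousLinearMap.id ℂ E - T‖ ≤ M}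
  have hC : Convex ℝ {w : G → StrongDual ℂ E |
      ∃ T ∈ S, ∀ z : G, w z = (z : StrongDual ℂ E).comp T} := by
    rintro v ⟨T, hT, hv⟩ w ⟨U, hU, hw⟩ a b ha hb hab
    refine ⟨a • T + b • U, convex_compact_norm_id_sub_le M hT hU ha hb hab, fun z => ?_⟩
    ext x
    simp [hv, hw]
  obtain ⟨w, ⟨T, hT, hw⟩, hlt⟩ := hC.exists_norm_sub_lt_of_weak
      (fun z => (z : StrongDual ℂ E)) (fun ψ δ hδ => by
        -- With `ψ z` represented by `x z`, `ψ z (z - T* z) = z (x z - T (x z))`, which the BCAP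
        -- makes small.
        choose x hx using fun z => hE (ψ z)
        set K : ℝ := ∑ z : G, ‖(z : StrongDual ℂ E)‖ with hK
        have hK0 : 0 ≤ K := Finset.sum_nonneg fun _ _ => norm_nonneg _
        obtain ⟨T, h1, h2, h3⟩ := h (δ / (K + 1)) (by positivity) (Finset.univ.image x)
        refine ⟨fun z => (z : StrongDual ℂ E).comp T, ⟨T, ⟨h1, h2⟩, fun _ => rfl⟩, ?_⟩
        calc ‖∑ z : G, ψ z (z - (z : StrongDual ℂ E).comp T)‖
            ≤ ∑ z : G, ‖(z : StrongDual ℂ E)‖ * (δ / (K + 1)) := by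
              refine (norm_sum_le _ _).trans (Finset.sum_le_sum fun z _ => ?_)
              rw [← hx, NormedSpace.dual_def, sub_apply, ContinuousLinearMap.comp_apply,
                ← map_sub]
              refine (ContinuousLinearMap.le_opNorm _ _).trans ?_
              gcongr
              exact (h3 _ (Finset.mem_image_of_mem x (Finset.mem_univ z))).le
          _ = K * (δ / (K + 1)) := by rw [← Finset.sum_mul]
          _ < δ := by
              rw [← mul_div_assoc, div_lt_iff₀ (by positivity)]
              linarith) hε
  refine ⟨T, hT.1, hT.2, fun z hz => ?_⟩
  have := hlt ⟨z, hz⟩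
  rwa [hw] at this

/-- The constant is an infimum, so constants `M + η` suffice. -/
lemma hasBCAP_of_forall_bcapWith {M : ℝ} (hM : 0 < M)
    (h : ∀ η : ℝ, 0 < η → BCAPWith E (M + η)) : HasBCAP E ∧ bcapConst E ≤ M := by
  refine ⟨⟨M + 1, by linarith, h 1 one_pos⟩, le_of_forall_pos_le_add fun η hη => ?_⟩
  exact csInf_le ⟨0, fun _ hx => hx.1.le⟩ ⟨by linarith, h η hη⟩

lemma hasDCAP_of_forall_dcapWith {M : ℝ} (hM : 0 < M)
    (h : ∀ η : ℝ, 0 < η → DCAPWith E (M + η)) : HasDCAP E ∧ dcapConst E ≤ M := by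
  refine ⟨⟨M + 1, by linarith, h 1 one_pos⟩, le_of_forall_pos_le_add fun η hη => ?_⟩
  exact csInf_le ⟨0, fun _ hx => hx.1.le⟩ ⟨by linarith, h η hη⟩

end Duality

/-! ### Banach function spaces inside `L¹` -/

namespace BanachFunctionNorm

variable (ρ : BanachFunctionNorm)

/-- Lower semicontinuity: sublevel sets of a Banach function norm are closed in `L¹`. -/
lemma isClosed_eval_le (c : ℝ≥0∞) :
    IsClosed {f : CircL1 | ρ.eval (f : TCirc →ₘ[circMeasure] ℂ) ≤ c} := by
  refine IsSeqClosed.isClosed fun f g hf hfg => ?_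
  obtain ⟨ns, -, hns⟩ := (tendstoInMeasure_of_tendsto_Lp hfg).exists_seq_tendsto_ae
  -- Tail infima increase to the liminf, which is `|g|` a.e., and lie below `|f (ns n)|`: Fatou's
  -- lemma from the monotone property.
  let u : ℕ → TCirc → ℝ≥0∞ := fun n t => ⨅ i, ‖f (ns (i + n)) t‖ₑ
  have hu : ∀ n, Measurable (u n) := fun n => .iInf fun i => measurable_enorm_coe _
  have humono : ∀ t, Monotone fun n => u n t := fun t n m hnm => by
    refine le_iInf fun i => (iInf_le _ (i + (m - n))).trans (le_of_eq ?_)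
    have h : i + (m - n) + n = i + m := by omega
    simp only [h]
  have h := ρ.fatou u (fun t => ‖g t‖ₑ) hu (measurable_enorm_coe _) (ae_of_all _ humono) ?_
  · refine le_of_tendsto h.2 (Eventually.of_forall fun n => ?_)
    refine (ρ.mono _ _ (measurable_enorm_coe _) (hu n) (ae_of_all _ fun t => ?_)).trans
      (hf (ns n))
    exact (iInf_le _ 0).trans (by rw [zero_add])
  · filter_upwards [hns] with t ht
    have h1 := (continuous_enorm.tendsto (g t)).comp ht
    have h2 := tendsto_atTop_iSup (humono t)
    rw [← h1.liminf_eq, liminf_eq_iSup_iInf_of_nat']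
    exact h2

/-- The inclusion of a Banach function space in `L¹`. -/
def toL1 : ρ.space →L[ℂ] CircL1 :=
  LinearMap.mkContinuousOfExistsBound
    { toFun := fun f => ⟨f, by
        rw [Lp.mem_Lp_iff_memLp, memLp_one_iff_integrable]
        exact ρ.integrable_coe f⟩
      map_add' := fun _ _ => rfl
      map_smul' := fun _ _ => rfl } <| by
    obtain ⟨C, -, hC⟩ := ρ.lintegral_le
    refine ⟨C, fun f => ?_⟩
    rw [Lp.norm_def, norm_def, ← ENNReal.coe_toReal, ← ENNReal.toReal_mul]
    refine ENNReal.toReal_mono (ENNReal.mul_ne_top ENNReal.coe_ne_top (ne_of_lt f.2)) ?_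
    rw [eLpNorm_one_eq_lintegral_enorm]
    exact hC _ (measurable_enorm_coe _)

lemma toL1_val (f : ρ.space) : (ρ.toL1 f : TCirc →ₘ[circMeasure] ℂ) = f := rfl

lemma toL1_injective : Function.Injective ρ.toL1 := fun _ _ h =>
  Subtype.ext (congrArg (fun u : CircL1 => (u : TCirc →ₘ[circMeasure] ℂ)) h)

lemma eval_coe_eq_enorm (f : ρ.space) : ρ.eval f = ‖f‖ₑ := by
  rw [← ofReal_norm, norm_def, ENNReal.ofReal_toReal (ne_of_lt f.2)]

lemma IsTranslationInvariant.eval_trans {ρ : BanachFunctionNorm} (hρ : ρ.IsTranslationInvariant)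
    (θ : TCirc) (f : ρ.space) : ρ.eval (CircL1.trans θ (ρ.toL1 f)) = ρ.eval f := by
  obtain ⟨h, hn⟩ := hρ θ f
  rw [norm_def, norm_def, ENNReal.toReal_eq_toReal_iff' (ne_of_lt h) (ne_of_lt f.2)] at hn
  exact hn

lemma mem_hardy_iff (f : ρ.space) :
    f ∈ ρ.hardy ↔ ∀ n : ℤ, n < 0 → CircL1.coeff n (ρ.toL1 f) = 0 := Iff.rfl

/-- Fourier coefficients are continuous on `X` through `L¹`. This lets `H[X]` inherit reflexivity.
-/
lemma isClosed_hardy : IsClosed (ρ.hardy : Set ρ.space) := by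
  have : (ρ.hardy : Set ρ.space) =
      ⋂ (n : ℤ) (_ : n < 0), {f | CircL1.coeff n (ρ.toL1 f) = 0} := by
    ext f
    simp only [SetLike.mem_coe, mem_hardy_iff, Set.mem_iInter, Set.mem_ofPred_eq]
  rw [this]
  exact isClosed_iInter fun n => isClosed_iInter fun _ =>
    isClosed_eq (by fun_prop) continuous_const

/-- The character of index `n`, as an element of a Banach function space. -/
def character (n : ℤ) : ρ.space :=
  ⟨(fourierLp 1 n : CircL1), by
    refine lt_of_le_of_lt (ρ.mono _ _ measurable_const (measurable_enorm_coe _) ?_) ρ.one_lt_top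
    filter_upwards [coeFn_fourierLp (T := 2 * Real.pi) 1 n] with t ht
    rw [ht, ← ofReal_norm, fourier_apply, Circle.norm_coe, ENNReal.ofReal_one]⟩

lemma character_mem_hardy {n : ℤ} (hn : 0 ≤ n) : ρ.character n ∈ ρ.hardy := fun m hm => by
  change CircL1.coeff m (fourierLp 1 n) = 0
  rw [CircL1.coeff_fourierLp, Pi.single_eq_of_ne (by omega)]

/-- The inclusion of the Hardy space in `L¹`. -/
def hardyToL1 : ρ.hardy →L[ℂ] CircL1 := ρ.toL1.comp ρ.hardy.subtypeL

lemma hardyToL1_apply (y : ρ.hardy) : ρ.hardyToL1 y = ρ.toL1 y := rfl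

/-- Convolution with a trigonometric polynomial is a compact operator on the Hardy space. -/
lemma exists_compact_eq_conv {p : C(TCirc, ℂ)}
    (hp : p ∈ Submodule.span ℂ (Set.range (fourier (T := 2 * Real.pi)))) :
    ∃ T : ρ.hardy →L[ℂ] ρ.hardy, IsCompactOperator T ∧
      ∀ y, ρ.hardyToL1 (T y) = CircL1.conv p (ρ.hardyToL1 y) := by
  induction hp using Submodule.span_induction with
  | mem x hx =>
    obtain ⟨n, rfl⟩ := hx
    rcases le_or_gt 0 n with hn | hn
    · let e : ρ.hardy := ⟨ρ.character n, ρ.character_mem_hardy hn⟩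
      refine ⟨(ContinuousLinearMap.toSpanSingleton ℂ e).comp
          ((CircL1.coeff n).comp ρ.hardyToL1), ?_, fun y => ?_⟩
      · exact (isCompactOperator_of_locallyCompactSpace_dom
          ((CircL1.coeff n).comp ρ.hardyToL1)).clm_comp
            (ContinuousLinearMap.toSpanSingleton ℂ e)
      · rw [CircL1.conv_fourier, ContinuousLinearMap.comp_apply,
          ContinuousLinearMap.toSpanSingleton_apply, map_smul]
        rfl
    -- Negative frequencies are annihilated on the Hardy space, so `p` may have any spectrum.
    · refine ⟨0, isCompactOperator_zero, fun y => ?_⟩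
      rw [CircL1.conv_fourier, hardyToL1_apply ρ y, (ρ.mem_hardy_iff _).1 y.2 n hn, zero_smul,
        zero_apply, map_zero]
  | zero => exact ⟨0, isCompactOperator_zero, fun y => by
      rw [CircL1.conv_zero, zero_apply, map_zero]⟩
  | add p q _ _ hp hq =>
    obtain ⟨S, hS, hS'⟩ := hp
    obtain ⟨T, hT, hT'⟩ := hq
    exact ⟨S + T, hS.add hT, fun y => by
      rw [CircL1.conv_add, add_apply, map_add, hS', hT']⟩
  | smul a p _ hp =>
    obtain ⟨S, hS, hS'⟩ := hp
    exact ⟨a • S, hS.smul a, fun y => by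
      rw [CircL1.conv_smul, smul_apply, map_smul, hS']⟩

variable {ρ}

/-- Compact convolution operators on the Hardy space, controlled by the translates with parameter
in a prescribed neighbourhood of `0`, both in the norm of the space and in `L¹`. -/
lemma IsTranslationInvariant.exists_compact_approx (hρ : ρ.IsTranslationInvariant)
    {V : Set TCirc} (hV : V ∈ 𝓝 0) {η : ℝ} (hη : 0 < η) :
    ∃ T : ρ.hardy →L[ℂ] ρ.hardy, IsCompactOperator T ∧
      ‖ContinuousLinearMap.id ℂ ρ.hardy - T‖ ≤ 2 + η ∧
      (∀ (y : ρ.hardy) (c : ℝ), 0 ≤ c →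
        (∀ θ ∈ V, ρ.eval ((ρ.toL1 y - CircL1.trans θ (ρ.toL1 y) : CircL1) :
          TCirc →ₘ[circMeasure] ℂ) ≤ ENNReal.ofReal c) → ‖y - T y‖ ≤ c + η * ‖y‖) ∧
      (∀ (y : ρ.hardy) (c : ℝ), 0 ≤ c →
        (∀ θ ∈ V, ‖ρ.hardyToL1 y - CircL1.trans θ (ρ.hardyToL1 y)‖ ≤ c) →
        ‖ρ.hardyToL1 (y - T y)‖ ≤ c + η * ‖ρ.hardyToL1 y‖) := by
  obtain ⟨φ, hφ, hφV⟩ := CircL1.exists_density hV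
  let k : C(TCirc, ℂ) := ⟨fun θ => ((φ θ : ℝ) : ℂ), by fun_prop⟩
  obtain ⟨p, hp, hkp⟩ := CircL1.exists_trigPoly_norm_sub_le k hη
  obtain ⟨T, hTc, hT⟩ := ρ.exists_compact_eq_conv hp
  have key : ∀ (y : ρ.hardy) (c : ℝ), 0 ≤ c →
      (∀ θ, φ θ ≠ 0 → ρ.eval ((ρ.toL1 y - CircL1.trans θ (ρ.toL1 y) : CircL1) :
        TCirc →ₘ[circMeasure] ℂ) ≤ ENNReal.ofReal c) → ‖y - T y‖ ≤ c + η * ‖y‖ := by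
    intro y c hc h
    have h1 := CircL1.sub_conv_le
      (N := fun f : CircL1 => ρ.eval (f : TCirc →ₘ[circMeasure] ℂ)) ρ.isClosed_eval_le
      (fun f g => ρ.eval_add_le f g) (fun c f => ρ.eval_smul c f) hφ (fun _ => rfl) hkp
      (fun θ => (hρ.eval_trans θ y).le) h
    have h2 : ρ.toL1 y - CircL1.conv p (ρ.toL1 y) = ρ.toL1 ((y - T y : ρ.hardy) : ρ.space) := by
      have := hT y
      rw [hardyToL1_apply, hardyToL1_apply] at this
      rw [← this, Submodule.coe_sub, map_sub]
    rw [h2] at h1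
    simp only [toL1_val, eval_coe_eq_enorm] at h1
    rw [← ofReal_norm, ← ofReal_norm, ← ENNReal.ofReal_mul hη.le,
      ← ENNReal.ofReal_add hc (by positivity),
      ENNReal.ofReal_le_ofReal_iff (by positivity)] at h1
    exact h1
  refine ⟨T, hTc, ?_, fun y c hc h => key y c hc fun θ hθ => h θ (hφV θ hθ), ?_⟩
  · refine ContinuousLinearMap.opNorm_le_bound _ (by positivity) fun y => ?_
    -- The constant `2` is the triangle inequality for `y - τ_θ y`, valid for every `θ`.
    refine (key y (2 * ‖y‖) (by positivity) fun θ _ => ?_).trans_eq (by ring)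
    have h : ρ.toL1 y - CircL1.trans θ (ρ.toL1 y) = ρ.toL1 y + -CircL1.trans θ (ρ.toL1 y) :=
      sub_eq_add_neg _ _
    rw [h]
    refine (ρ.eval_add_le _ _).trans ?_
    have h' := ρ.eval_neg (CircL1.trans θ (ρ.toL1 y) : CircL1)
    rw [hρ.eval_trans, eval_coe_eq_enorm] at h'
    refine (add_le_add (ρ.eval_coe_eq_enorm y).le h'.le).trans ?_
    rw [← two_mul, ENNReal.ofReal_mul two_pos.le, ofReal_norm, ENNReal.ofReal_ofNat]
    exact le_rfl
  · intro y c hc h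
    have h1 := CircL1.sub_conv_le (N := fun f : CircL1 => ‖f‖ₑ)
      (fun c => isClosed_le continuous_enorm continuous_const)
      (fun f g => enorm_add_le f g) (fun c f => enorm_smul c f) hφ (fun _ => rfl) hkp
      (f := ρ.hardyToL1 y) (c := ENNReal.ofReal c)
      (fun θ => by rw [← ofReal_norm, ← ofReal_norm, LinearIsometry.norm_map])
      (fun θ hθ => by
        rw [← ofReal_norm]
        exact ENNReal.ofReal_le_ofReal (h θ (hφV θ hθ)))
    rw [← hT, ← map_sub, ← ofReal_norm, ← ofReal_norm, ← ENNReal.ofReal_mul hη.le,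
      ← ENNReal.ofReal_add hc (by positivity),
      ENNReal.ofReal_le_ofReal_iff (by positivity)] at h1
    exact h1

/-- In a separable translation-invariant space translation is continuous. -/
lemma IsTranslationInvariant.eventually_eval_sub_trans_le (hρ : ρ.IsTranslationInvariant)
    [TopologicalSpace.SeparableSpace ρ.space] (f : ρ.space) {ε : ℝ} (hε : 0 < ε) :
    ∀ᶠ θ in 𝓝 (0 : TCirc), ρ.eval ((ρ.toL1 f - CircL1.trans θ (ρ.toL1 f) : CircL1) :
      TCirc →ₘ[circMeasure] ℂ) ≤ ENNReal.ofReal ε := by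
  let orbit : TCirc → ρ.space := fun θ => ⟨translate θ f, (hρ θ f).choose⟩
  have horbit : ∀ θ, ρ.toL1 (orbit θ) = CircL1.trans θ (ρ.toL1 f) := fun θ => rfl
  let x : ℕ → ρ.space := TopologicalSpace.denseSeq ρ.space
  -- Closed, although the orbit is not yet known to be continuous in `X`: it is continuous in `L¹`,
  -- where the sublevel sets of `ρ` are closed.
  let A : ℕ → Set TCirc := fun i => {θ | ρ.eval
    ((CircL1.trans θ (ρ.toL1 f) - ρ.toL1 (x i) : CircL1) : TCirc →ₘ[circMeasure] ℂ) ≤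
      ENNReal.ofReal (ε / 2)}
  have hA : ∀ i, IsClosed (A i) := fun i =>
    (ρ.isClosed_eval_le (ENNReal.ofReal (ε / 2))).preimage
      ((CircL1.continuous_trans (ρ.toL1 f)).sub continuous_const)
  have hcover : ⋃ i, A i = Set.univ := by
    refine Set.eq_univ_of_forall fun θ => ?_
    obtain ⟨i, hi⟩ := (TopologicalSpace.denseRange_denseSeq ρ.space).exists_dist_lt
      (orbit θ) (half_pos hε)
    refine Set.mem_iUnion.2 ⟨i, ?_⟩
    change ρ.eval ((orbit θ - x i : ρ.space) : TCirc →ₘ[circMeasure] ℂ) ≤ _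
    rw [eval_coe_eq_enorm, ← ofReal_norm]
    rw [dist_eq_norm] at hi
    exact ENNReal.ofReal_le_ofReal hi.le
  -- Baire category; invariance under `τ_θ₀` then moves the estimate from `θ₀` to `0`.
  obtain ⟨i, θ₀, hθ₀⟩ := nonempty_interior_of_iUnion_of_closed hA hcover
  have hnear : ∀ᶠ θ in 𝓝 (0 : TCirc), θ₀ + θ ∈ A i := by
    have hc : ContinuousAt (fun θ : TCirc => θ₀ + θ) 0 := by fun_prop
    apply hc.eventually_mem
    rw [add_zero]
    exact mem_interior_iff_mem_nhds.1 hθ₀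
  filter_upwards [hnear] with θ hθ
  have h0 : ρ.eval ((orbit θ₀ - x i : ρ.space) : TCirc →ₘ[circMeasure] ℂ) ≤
      ENNReal.ofReal (ε / 2) :=
    (interior_subset hθ₀ : θ₀ ∈ A i)
  have h1 : ρ.eval ((orbit (θ₀ + θ) - x i : ρ.space) : TCirc →ₘ[circMeasure] ℂ) ≤
      ENNReal.ofReal (ε / 2) := hθ
  have h2 : CircL1.trans θ₀ (ρ.toL1 (f - orbit θ)) = ρ.toL1 (orbit θ₀ - orbit (θ₀ + θ)) := by
    rw [map_sub, map_sub, map_sub, horbit, horbit, horbit, CircL1.trans_add]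
  have h3 := hρ.eval_trans θ₀ (f - orbit θ)
  rw [h2, toL1_val] at h3
  change ρ.eval ((f - orbit θ : ρ.space) : TCirc →ₘ[circMeasure] ℂ) ≤ _
  rw [← h3]
  rw [eval_coe_eq_enorm, ← ofReal_norm, ENNReal.ofReal_le_ofReal_iff (half_pos hε).le] at h0 h1
  rw [eval_coe_eq_enorm, ← ofReal_norm, ENNReal.ofReal_le_ofReal_iff hε.le]
  calc ‖orbit θ₀ - orbit (θ₀ + θ)‖ = ‖(orbit θ₀ - x i) - (orbit (θ₀ + θ) - x i)‖ := by
        congr 1; abel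
    _ ≤ ‖orbit θ₀ - x i‖ + ‖orbit (θ₀ + θ) - x i‖ := norm_sub_le _ _
    _ ≤ ε := by linarith

lemma IsTranslationInvariant.bcapWith_of_separable (hρ : ρ.IsTranslationInvariant)
    [TopologicalSpace.SeparableSpace ρ.space] {η : ℝ} (hη : 0 < η) :
    BCAPWith ρ.hardy (2 + η) := by
  intro ε hε F
  have hK0 : 0 ≤ ∑ y ∈ F, ‖y‖ := Finset.sum_nonneg fun _ _ => norm_nonneg _
  set K : ℝ := ∑ y ∈ F, ‖y‖
  have hV : ∀ᶠ θ in 𝓝 (0 : TCirc), ∀ y ∈ F,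
      ρ.eval ((ρ.toL1 y - CircL1.trans θ (ρ.toL1 y) : CircL1) : TCirc →ₘ[circMeasure] ℂ) ≤
        ENNReal.ofReal (ε / 2) :=
    (eventually_all_finset F).2 fun y _ => hρ.eventually_eval_sub_trans_le y (half_pos hε)
  -- The first entry of the minimum keeps the norm bound, the second makes the error `η ‖y‖` less
  -- than `ε / 2` on `F`.
  obtain ⟨T, hT, hTn, hTa, -⟩ := hρ.exists_compact_approx hV
    (η := min η (ε / 2 / (K + 1))) (by positivity)
  refine ⟨T, hT, hTn.trans (by gcongr; exact min_le_left _ _), fun y hy => ?_⟩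
  refine (hTa y (ε / 2) (by positivity) fun θ hθ => hθ y hy).trans_lt ?_
  have hyK : ‖y‖ ≤ K := Finset.single_le_sum (f := fun y => ‖y‖) (fun _ _ => norm_nonneg _) hy
  calc ε / 2 + min η (ε / 2 / (K + 1)) * ‖y‖ ≤ ε / 2 + ε / 2 / (K + 1) * K := by
        gcongr
        exact min_le_right _ _
    _ < ε := by
        have : ε / 2 / (K + 1) * K < ε / 2 := by
          rw [div_mul_eq_mul_div, div_lt_iff₀ (by positivity)]
          linarith
        linarith

/-- Compact operators that approximate finitely many elements of the Hardy space in `L¹`. -/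
lemma IsTranslationInvariant.exists_compact_norm_hardyToL1_sub_lt (hρ : ρ.IsTranslationInvariant)
    {η : ℝ} (hη : 0 < η) {ε : ℝ} (hε : 0 < ε) (F : Finset ρ.hardy) :
    ∃ T : ρ.hardy →L[ℂ] ρ.hardy, IsCompactOperator T ∧
      ‖ContinuousLinearMap.id ℂ ρ.hardy - T‖ ≤ 2 + η ∧
      ∀ y ∈ F, ‖ρ.hardyToL1 (y - T y)‖ < ε := by
  have hK0 : 0 ≤ ∑ y ∈ F, ‖ρ.hardyToL1 y‖ := Finset.sum_nonneg fun _ _ => norm_nonneg _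
  set K : ℝ := ∑ y ∈ F, ‖ρ.hardyToL1 y‖
  have hV : ∀ᶠ θ in 𝓝 (0 : TCirc), ∀ y ∈ F,
      ‖ρ.hardyToL1 y - CircL1.trans θ (ρ.hardyToL1 y)‖ ≤ ε / 2 :=
    (eventually_all_finset F).2 fun y _ => by
      have hc : Continuous fun θ => ‖ρ.hardyToL1 y - CircL1.trans θ (ρ.hardyToL1 y)‖ :=
        (continuous_const.sub (CircL1.continuous_trans _)).norm
      refine (hc.continuousAt.eventually_lt continuousAt_const ?_).mono fun θ h => h.le
      rw [CircL1.trans_zero, sub_self, norm_zero]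
      positivity
  obtain ⟨T, hT, hTn, -, hTa⟩ := hρ.exists_compact_approx hV
    (η := min η (ε / 2 / (K + 1))) (by positivity)
  refine ⟨T, hT, hTn.trans (by gcongr; exact min_le_left _ _), fun y hy => ?_⟩
  refine (hTa y (ε / 2) (by positivity) fun θ hθ => hθ y hy).trans_lt ?_
  have hyK : ‖ρ.hardyToL1 y‖ ≤ K :=
    Finset.single_le_sum (f := fun y => ‖ρ.hardyToL1 y‖) (fun _ _ => norm_nonneg _) hy
  calc ε / 2 + min η (ε / 2 / (K + 1)) * ‖ρ.hardyToL1 y‖ ≤ ε / 2 + ε / 2 / (K + 1) * K := by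
        gcongr
        exact min_le_right _ _
    _ < ε := by
        have : ε / 2 / (K + 1) * K < ε / 2 := by
          rw [div_mul_eq_mul_div, div_lt_iff₀ (by positivity)]
          linarith
        linarith

/-- Continuity of translation in `L¹` replaces continuity in `X`, so no separability enters. -/
lemma IsTranslationInvariant.bcapWith_of_isReflexiveSpace (hρ : ρ.IsTranslationInvariant)
    (hr : IsReflexiveSpace ρ.hardy) {η : ℝ} (hη : 0 < η) : BCAPWith ρ.hardy (2 + η) := by
  exact BCAPWith.of_injective hr (by linarith) ρ.hardyToL1
    (ρ.toL1_injective.comp Subtype.val_injective) fun F ε hε =>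
      hρ.exists_compact_norm_hardyToL1_sub_lt hη hε F

end BanachFunctionNorm

end

theorem theorem3p3 (ρ : BanachFunctionNorm) (hρ : ρ.IsTranslationInvariant) :
    (TopologicalSpace.SeparableSpace ρ.space →
      HasBCAP ρ.hardy ∧ bcapConst ρ.hardy ≤ 2) ∧
    (IsReflexiveSpace ρ.space →
      (HasBCAP ρ.hardy ∧ bcapConst ρ.hardy ≤ 2) ∧
      (HasDCAP ρ.hardy ∧ dcapConst ρ.hardy ≤ 2)) := by
  refine ⟨fun _ => hasBCAP_of_forall_bcapWith two_pos fun η hη => hρ.bcapWith_of_separable hη,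
    fun hX => ?_⟩
  have hr : IsReflexiveSpace ρ.hardy := hX.of_isClosed ρ.hardy ρ.isClosed_hardy
  have hB : ∀ η : ℝ, 0 < η → BCAPWith ρ.hardy (2 + η) := fun η hη =>
    hρ.bcapWith_of_isReflexiveSpace hr hη
  exact ⟨hasBCAP_of_forall_bcapWith two_pos hB,
    hasDCAP_of_forall_dcapWith two_pos fun η hη => (hB η hη).dcapWith hr⟩
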